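/- **Setting.** Let $\mathcal C\subset\mathbb R^p$ be a convex set with the origin in its interior, let $\|x\|_{\mathcal C}=\inf\{t>0: x\in t\,\mathcal C\}$ be its Minkowski functional and $\partial\|x\|_{\mathcal C}$ the subdifferential of this function at $x$. For $\lambda\ge 0$ let $\mathrm{prox}_\lambda(y)=\arg\min_x \tfrac12\|y-x\|_2^2+\lambda\|x\|_{\mathcal C}$. Let $Y[t]=X^\star[t]+\varepsilon[t]$, $t=1,\dots,n$, where $X^\star[t]\in\mathbb R^p$ is deterministic and the $\varepsilon[t]\sim\mathcal N(0,\sigma^2 I_{p\times p})$ are independent, $\sigma>0$. Put $\mathcal X=\{X^\star[1],\dots,X^\star[n]\}$, $$f(\lambda)=\max_{1\le t\le n}\ \mathbb E_{g\sim\mathcal N(0,I_{p\times p})}\big[\mathrm{dist}(g,\lambda\cdot\partial\|X^\star[t]\|_{\mathcal C})\big],\qquad \eta_{\mathcal C}(\mathcal X)=\inf_{\lambda\ge0} f(\lambda).$$ Let $\tau^\star=\{1\le t<n: X^\star[t]\ne X^\star[t+1]\}$ be the set of change-points, assumed to have at least two elements, $\Delta_{\min}=\min_{t\in\tau^\star}\|X^\star[t]-X^\star[t+1]\|_2$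 and $T_{\min}=\min\{|t-t'|: t,t'\in\tau^\star,\ t\ne t'\}$. Suppose that, for some $r>1$, $$\Delta_{\min}^2T_{\min}\ge 64\sigma^2\{\eta_{\mathcal C}(\mathcal X)+r\sqrt{2\log n}\}^2,\qquad \tau^\star\subset[T_{\min}/4,\ n-T_{\min}/4].$$ **Algorithm.** Let the integer $\theta\ge1$ and the real $\gamma$ satisfy $\theta\le T_{\min}/4$ and $2\frac{\sigma}{\sqrt\theta}\{\eta_{\mathcal C}(\mathcal X)+r\sqrt{2\log n}\}\le\gamma\le\Delta_{\min}/2$, and let $\lambda=\frac{\sigma}{\sqrt\theta}\tilde\lambda$, where $\tilde\lambda$ is a minimizer of $f$ over $[0,\infty)$. Compute $\bar Y[i]=\frac1\theta\sum_{t=i}^{i+\theta-1}Y[t]$, $\hat X[i]=\mathrm{prox}_\lambda(\bar Y[i])$ and $S[t]=\|\hat X[t+1]-\hat X[t-\theta+1]\|_2$ for $\theta\le t\le n-\theta$; set $S[t]=0$ wherever $S[t]<\gamma$; group the indices of the non-zero entries of $S$ so that consecutive ones are in the same group when they are at most $\theta$ apart; select in each group one index with the largest value of $S$ (ties broken arbitrarily).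 The selected indices form the estimate $\hat\tau$. **Reconstruction.** For times $t_1<t_2$ with $t_2-t_1>2\theta$ put $\bar Y=\frac1{t_2-t_1-2\theta}\sum_{t=t_1+\theta+1}^{t_2-\theta}Y[t]$ and $\bar X=\mathrm{prox}_{\lambda'}(\bar Y)$ with $\lambda'=\frac{\sigma}{\sqrt{t_2-t_1-2\theta}}\tilde\lambda'$, where $\tilde\lambda'$ is a minimizer of $f$ over $[0,\infty)$. For $s\in\mathbb R$ consider the error bound $$\|\bar X-X^\star[t]\|_2^2\le\frac{2\sigma^2}{t_2-t_1-2\theta}\{\eta_{\mathcal C}(\mathcal X)^2+s^2\}\quad\text{for all } t_1+\theta+1\le t\le t_2-\theta \tag{1}$$ (a void condition if there is no such $t$). **Claim.** (a) For all fixed $t_1,t_2$ and $s$, with probability greater than $1-4n^{1-r^2}-\exp(-s^2/2)$ the following holds: if $t_1<t_2$ are consecutive elements of $\hat\tau$, then (1) holds. (b) Moreover there is an event $G$, not depending on $t_1,t_2,s$, with $\mathbb P(G)>1-4n^{1-r^2}$, such that for all $t_1<t_2$ that are consecutive elements of $\hat\tau$ for some outcome in $G$, and for every $s$, with probability greater than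 $1-4n^{1-r^2}-\exp(-s^2/2)$ both $G$ and (1) hold. -/

import Mathlib

open MeasureTheory ProbabilityTheory
open scoped Pointwise

namespace ChangePoint

/-- The signal space `ℝ^p` with its Euclidean norm. -/
abbrev Vec (p : ℕ) : Type := EuclideanSpace ℝ (Fin p)

noncomputable section

/-! ### Convex geometry: subdifferential, proximal operator, Gaussian distance

The Minkowski functional `‖x‖_C = inf {t > 0 : x ∈ t C}` is Mathlib's `gauge C x`. -/

/-- The subdifferential at `x` of the function `f`. -/
def subdiff {p : ℕ} (f : Vec p → ℝ) (x : Vec p) : Set (Vec p) :=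
  {w | ∀ z : Vec p, f x + inner ℝ w (z - x) ≤ f z}

/-- `x` minimizes `(1/2) ‖y - x‖² + l ‖x‖_C`. -/
def IsProx {p : ℕ} (C : Set (Vec p)) (l : ℝ) (y x : Vec p) : Prop :=
  ∀ z : Vec p, (1 / 2) * ‖y - x‖ ^ 2 + l * gauge C x ≤ (1 / 2) * ‖y - z‖ ^ 2 + l * gauge C z

/-- The proximal denoiser `argmin_x (1/2) ‖y - x‖² + l ‖x‖_C`. The minimizer exists and is unique
when `C` is convex with the origin in its interior and `0 ≤ l`. -/
def prox {p : ℕ} (C : Set (Vec p)) (l : ℝ) (y : Vec p) : Vec p :=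
  Classical.epsilon (IsProx C l y)

/-- `E_{g ∼ N(0, I)} [dist (g, l · ∂‖x‖_C)]`. -/
def expDist {p : ℕ} (C : Set (Vec p)) (x : Vec p) (l : ℝ) : ℝ :=
  ∫ g, Metric.infDist g (l • subdiff (gauge C) x) ∂(stdGaussian (Vec p))

/-- `max_{1 ≤ t ≤ n} E_{g ∼ N(0, I)} [dist (g, l · ∂‖X[t]‖_C)]`. -/
def worstExpDist {p : ℕ} (C : Set (Vec p)) (n : ℕ) (X : ℕ → Vec p) (l : ℝ) : ℝ :=
  ⨆ t : Finset.Icc 1 n, expDist C (X t) l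

/-- The Gaussian distance `η_C(𝒳) = inf_{l ≥ 0} max_t E_g [dist (g, l · ∂‖X[t]‖_C)]`. -/
def gaussianDist {p : ℕ} (C : Set (Vec p)) (n : ℕ) (X : ℕ → Vec p) : ℝ :=
  ⨅ l : Set.Ici (0 : ℝ), worstExpDist C n X l

/-- `l` is a minimizer over `[0, ∞)` of `max_t E_g [dist (g, l · ∂‖X[t]‖_C)]`. -/
def IsArgmin {p : ℕ} (C : Set (Vec p)) (n : ℕ) (X : ℕ → Vec p) (l : ℝ) : Prop :=
  0 ≤ l ∧ ∀ l' : ℝ, 0 ≤ l' → worstExpDist C n X l ≤ worstExpDist C n X l'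

/-! ### Change-points of the signal -/

/-- The set `τ⋆` of the change-points of `X[1], …, X[n]`. -/
def changePoints {p : ℕ} (n : ℕ) (X : ℕ → Vec p) : Set ℕ :=
  {t | 1 ≤ t ∧ t < n ∧ X t ≠ X (t + 1)}

/-- The size of the smallest change (a minimum as soon as there is a change-point). -/
def deltaMin {p : ℕ} (n : ℕ) (X : ℕ → Vec p) : ℝ :=
  sInf ((fun t => ‖X t - X (t + 1)‖) '' changePoints n X)

/-- The smallest distance between two distinct change-points (a minimum as soon as there are
two change-points). -/
def Tmin {p : ℕ} (n : ℕ) (X : ℕ → Vec p) : ℕ :=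
  sInf {d | ∃ a ∈ changePoints n X, ∃ b ∈ changePoints n X, a < b ∧ d = b - a}

/-! ### The change-point estimation algorithm -/

/-- Filtering: `Ȳ[i] = (1/θ) ∑_{t = i}^{i + θ - 1} Y[t]`. -/
def filtered {p : ℕ} (θ : ℕ) (Y : ℕ → Vec p) (i : ℕ) : Vec p :=
  (1 / (θ : ℝ)) • ∑ t ∈ Finset.Ico i (i + θ), Y t

/-- Denoising: `X̂[i]` is the proximal denoiser applied to `Ȳ[i]`. -/
def denoised {p : ℕ} (C : Set (Vec p)) (l : ℝ) (θ : ℕ) (Y : ℕ → Vec p) (i : ℕ) : Vec p :=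
  prox C l (filtered θ Y i)

/-- Differencing: `S[t] = ‖X̂[t+1] - X̂[t-θ+1]‖`, used for `θ ≤ t ≤ n - θ`. -/
def diffStat {p : ℕ} (C : Set (Vec p)) (l : ℝ) (θ : ℕ) (Y : ℕ → Vec p) (t : ℕ) : ℝ :=
  ‖denoised C l θ Y (t + 1) - denoised C l θ Y (t + 1 - θ)‖

/-- Thresholding: the entries below `γ` are set to zero. -/
def thresholded (γ : ℝ) (S : ℕ → ℝ) (t : ℕ) : ℝ :=
  if S t < γ then 0 else S t

/-- The indices `θ ≤ t ≤ n - θ` of the non-zero entries. -/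
def nonzeroIdx (n θ : ℕ) (S : ℕ → ℝ) : Set ℕ :=
  {t | θ ≤ t ∧ t + θ ≤ n ∧ S t ≠ 0}

/-- Indices `t`, `u` of non-zero entries are in the same group: one gets from `t` to `u` through
non-zero entries by steps of length at most `θ`. -/
def SameGroup (n θ : ℕ) (S : ℕ → ℝ) (t u : ℕ) : Prop :=
  Relation.ReflTransGen
    (fun a b => a ∈ nonzeroIdx n θ S ∧ b ∈ nonzeroIdx n θ S ∧ a ≤ b + θ ∧ b ≤ a + θ) t u

/-- `T` consists of one index of the largest value of `S` in every group (ties are broken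
arbitrarily). -/
def IsSelection (n θ : ℕ) (S : ℕ → ℝ) (T : Finset ℕ) : Prop :=
  (∀ t ∈ T, t ∈ nonzeroIdx n θ S ∧ ∀ u, SameGroup n θ S t u → S u ≤ S t) ∧
    ∀ u ∈ nonzeroIdx n θ S, ∃! t, t ∈ T ∧ SameGroup n θ S u t

/-- `T` is an output `τ̂` of the algorithm on the observations `Y[1], …, Y[n]` with the parameters
`θ, γ, l` and the convex set `C`. -/
def IsEstimate {p : ℕ} (C : Set (Vec p)) (n θ : ℕ) (γ l : ℝ) (Y : ℕ → Vec p)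
    (T : Finset ℕ) : Prop :=
  IsSelection n θ (thresholded γ (diffStat C l θ Y)) T

/-- `a < b` are consecutive elements of `T`. -/
def Consecutive (T : Finset ℕ) (a b : ℕ) : Prop :=
  a ∈ T ∧ b ∈ T ∧ a < b ∧ ∀ u ∈ T, ¬ (a < u ∧ u < b)

/-! ### Signal reconstruction -/

/-- The number `t₂ - t₁ - 2θ` of the times in `{t₁ + θ + 1, …, t₂ - θ}` (when this set is
non-empty), as a real number. -/
def duration (θ t₁ t₂ : ℕ) : ℝ := (t₂ : ℝ) - t₁ - 2 * θ

/-- The average of the observations over `{t₁ + θ + 1, …, t₂ - θ}`. -/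
def innerMean {p : ℕ} (θ : ℕ) (Y : ℕ → Vec p) (t₁ t₂ : ℕ) : Vec p :=
  (1 / duration θ t₁ t₂) • ∑ t ∈ Finset.Icc (t₁ + θ + 1) (t₂ - θ), Y t

/-- The reconstruction `X̄`: the proximal denoiser with the parameter
`λ' = σ / √(t₂ - t₁ - 2θ) · l`, applied to the average. -/
def reconstruct {p : ℕ} (C : Set (Vec p)) (σ l : ℝ) (θ : ℕ) (Y : ℕ → Vec p) (t₁ t₂ : ℕ) : Vec p :=
  prox C (σ / √(duration θ t₁ t₂) * l) (innerMean θ Y t₁ t₂)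

/-- `‖X̄ - X[t]‖² ≤ 2σ² / (t₂ - t₁ - 2θ) · (η_C(𝒳)² + s²)` for all `t₁ + θ + 1 ≤ t ≤ t₂ - θ`. -/
def ErrorBound {p : ℕ} (C : Set (Vec p)) (n : ℕ) (X : ℕ → Vec p) (σ l s : ℝ) (θ : ℕ)
    (Y : ℕ → Vec p) (t₁ t₂ : ℕ) : Prop :=
  ∀ t ∈ Finset.Icc (t₁ + θ + 1) (t₂ - θ),
    ‖reconstruct C σ l θ Y t₁ t₂ - X t‖ ^ 2 ≤
      2 * σ ^ 2 / duration θ t₁ t₂ * (gaussianDist C n X ^ 2 + s ^ 2)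

end

end ChangePoint

namespace ChangePoint

open Set Filter Topology
open scoped NNReal ENNReal

/-! ### The Prékopa–Leindler inequality on the line -/

/-! Everything rests on one deterministic bound, `norm_prox_sub_le_infDist`: where the signal equals
`x`, the denoiser errs by at most the distance from the averaged noise to `λ ∂‖x‖_C`. An average of
`m` noise vectors is `σ/√m` times a standard Gaussian and `λ` carries the same factor, so this
distance is `σ/√m` times a 1-Lipschitz function of a standard Gaussian, with mean at most `η`. It
reaches `σ/√m (η + s)` with probability at most `exp(-s²/2)`. For `s = r √(2 log n)` and at most `n`
windows the union bound costs `n^(1-r²)`; the factor 4 in the claim is slack and yields the strict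
inequalities.

On the resulting event every constant window is denoised to within `γ/2`, and the rest is
combinatorial: `S` reaches `γ` at each change-point and stays below `γ` at indices at least `θ` away
from all of them. So each change-point has a selected index less than `θ` away, and trimming `θ`
from both ends between consecutive estimates leaves a constant stretch (`eq_of_consecutive`). This
constancy concerns the deterministic signal only: a pair of times seen once on the event can be
treated as fixed, and no conditioning on the estimate is needed.

Concentration with the sharp constant follows Maurey: Prékopa–Leindler on the line gives an
exponential transport inequality, which tensorizes (`integral_exp_le_exp_integral_pi`) and bounds
the moment generating function of a Lipschitz function. -/

/-- The Brunn–Minkowski inequality for compact subsets of the line. -/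
theorem volume_add_le_volume_add {A B : Set ℝ} (hA : IsCompact A) (hB : IsCompact B)
    (hA' : A.Nonempty) (hB' : B.Nonempty) : volume A + volume B ≤ volume (A + B) := by
  obtain ⟨a, ha, hau⟩ := hA.exists_isGreatest hA'
  obtain ⟨b, hb, hbl⟩ := hB.exists_isLeast hB'
  -- With `a = max A` and `b = min B`, the translates `b + A` and `a + B` lie in `A + B` and meet
  -- only at `a + b`.
  have h1 : volume (b +ᵥ A) = volume A := measure_vadd ..
  have h2 : volume (a +ᵥ B) = volume B := measure_vadd ..
  rw [← h1, ← h2, ← measure_union₀]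
  · apply measure_mono
    rintro x (⟨y, hy, rfl⟩ | ⟨y, hy, rfl⟩)
    · exact ⟨y, hy, b, hb, add_comm _ _⟩
    · exact ⟨a, ha, y, hy, rfl⟩
  · exact (hB.vadd a).measurableSet.nullMeasurableSet
  · refine measure_mono_null (t := {a + b}) ?_ (by simp)
    rintro x ⟨⟨y, hy, rfl⟩, ⟨z, hz, hzy⟩⟩
    have := hau hy
    have := hbl hz
    simp only [vadd_eq_add, mem_singleton_iff] at *
    linarith

theorem volume_convexCombination_ge {A B : Set ℝ} (hA : IsCompact A) (hB : IsCompact B)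
    (hA' : A.Nonempty) (hB' : B.Nonempty) {c d : ℝ} (hc : 0 ≤ c) (hd : 0 ≤ d) :
    ENNReal.ofReal c * volume A + ENNReal.ofReal d * volume B ≤ volume (c • A + d • B) := by
  have := volume_add_le_volume_add (hA.smul c) (hB.smul d) (hA'.smul_set) (hB'.smul_set)
  simpa [Measure.addHaar_smul, abs_of_nonneg hc, abs_of_nonneg hd] using this

/-- Layer-cake: since `u` and `v` both have maximum 1, their superlevel sets are nonempty for the
same levels `t ≤ 1`, where Brunn–Minkowski applies, and both empty for `t > 1`. -/
theorem lintegral_convexCombination_le {u v h : ℝ → ℝ} {c d : ℝ} (hc : 0 ≤ c) (hd : 0 ≤ d)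
    (hu0 : ∀ x, 0 ≤ u x) (hv0 : ∀ x, 0 ≤ v x) (hh0 : ∀ x, 0 ≤ h x)
    (hum : Measurable u) (hvm : Measurable v) (hhm : Measurable h)
    (hu1 : ∀ x, u x ≤ 1) (hv1 : ∀ x, v x ≤ 1) (hu : ∃ x, u x = 1) (hv : ∃ x, v x = 1)
    (huc : ∀ t, 0 < t → IsCompact {x | t ≤ u x}) (hvc : ∀ t, 0 < t → IsCompact {x | t ≤ v x})
    (huvh : ∀ t x y, 0 < t → t ≤ u x → t ≤ v y → t ≤ h (c * x + d * y)) :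
    ENNReal.ofReal c * (∫⁻ x, ENNReal.ofReal (u x)) +
        ENNReal.ofReal d * (∫⁻ x, ENNReal.ofReal (v x)) ≤ ∫⁻ x, ENNReal.ofReal (h x) := by
  rw [lintegral_eq_lintegral_meas_le _ (ae_of_all _ hu0) hum.aemeasurable,
    lintegral_eq_lintegral_meas_le _ (ae_of_all _ hv0) hvm.aemeasurable,
    lintegral_eq_lintegral_meas_le _ (ae_of_all _ hh0) hhm.aemeasurable,
    ← lintegral_const_mul' _ _ (by simp), ← lintegral_const_mul' _ _ (by simp),
    ← lintegral_add_left']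
  · refine setLIntegral_mono' measurableSet_Ioi fun t ht => ?_
    rcases le_or_gt t 1 with ht1 | ht1
    · obtain ⟨x, hx⟩ := hu
      obtain ⟨y, hy⟩ := hv
      refine (volume_convexCombination_ge (huc t ht) (hvc t ht) ⟨x, by simpa [hx]⟩
        ⟨y, by simpa [hy]⟩ hc hd).trans (measure_mono ?_)
      rintro _ ⟨_, ⟨x, hx, rfl⟩, _, ⟨y, hy, rfl⟩, rfl⟩
      exact huvh t x y ht hx hy
    · have h1 : {a | t ≤ u a} = ∅ := by
        ext a; simpa using (hu1 a).trans_lt ht1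
      have h2 : {a | t ≤ v a} = ∅ := by
        ext a; simpa using (hv1 a).trans_lt ht1
      simp [h1, h2]
  · have : Antitone fun t : ℝ => volume {a | t ≤ u a} :=
      fun s t hst => measure_mono fun a (ha : t ≤ u a) => hst.trans ha
    exact (this.measurable.const_mul _).aemeasurable

theorem exists_forall_le_of_isCompact_superlevel {u : ℝ → ℝ} (hu0 : ∀ x, 0 < u x)
    (hu : Continuous u) (huc : ∀ t, 0 < t → IsCompact {x | t ≤ u x}) : ∃ x₀, ∀ x, u x ≤ u x₀ := by
  obtain ⟨x₀, hx₀, h⟩ := (huc (u 0) (hu0 0)).exists_isMaxOn ⟨0, le_refl (u 0)⟩ hu.continuousOn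
  refine ⟨x₀, fun x => ?_⟩
  rcases le_total (u 0) (u x) with h0 | h0
  · exact h h0
  · exact h0.trans hx₀

/-- The Prékopa–Leindler inequality on the line, for positive continuous functions with compact
superlevel sets. -/
theorem rpow_integral_mul_rpow_integral_le {u v h : ℝ → ℝ} {c d : ℝ} (hc : 0 < c) (hd : 0 < d)
    (hcd : c + d = 1) (hu0 : ∀ x, 0 < u x) (hv0 : ∀ x, 0 < v x) (hh0 : ∀ x, 0 ≤ h x)
    (hu : Continuous u) (hv : Continuous v) (hhm : Measurable h)
    (huc : ∀ t, 0 < t → IsCompact {x | t ≤ u x}) (hvc : ∀ t, 0 < t → IsCompact {x | t ≤ v x})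
    (hui : Integrable u) (hvi : Integrable v) (hhi : Integrable h)
    (huvh : ∀ x y, u x ^ c * v y ^ d ≤ h (c * x + d * y)) :
    (∫ x, u x) ^ c * (∫ x, v x) ^ d ≤ ∫ x, h x := by
  obtain ⟨x₀, hx₀⟩ := exists_forall_le_of_isCompact_superlevel hu0 hu huc
  obtain ⟨y₀, hy₀⟩ := exists_forall_le_of_isCompact_superlevel hv0 hv hvc
  set a := u x₀
  set b := v y₀
  have ha : 0 < a := hu0 _
  have hb : 0 < b := hv0 _
  have hK : 0 < a ^ c * b ^ d := by positivity
  -- Dividing by the maxima equalizes the heights; the additive inequality obtained is stronger than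
  -- the multiplicative one, by AM–GM.
  have key := lintegral_convexCombination_le (u := fun x => u x / a) (v := fun x => v x / b)
    (h := fun x => h x / (a ^ c * b ^ d)) hc.le hd.le
    (fun x => (div_pos (hu0 x) ha).le) (fun x => (div_pos (hv0 x) hb).le)
    (fun x => div_nonneg (hh0 x) hK.le)
    (hu.measurable.div_const _) (hv.measurable.div_const _) (hhm.div_const _)
    (fun x => (div_le_one ha).2 (hx₀ x)) (fun x => (div_le_one hb).2 (hy₀ x))
    ⟨x₀, div_self ha.ne'⟩ ⟨y₀, div_self hb.ne'⟩
    (fun t ht => by simpa only [le_div_iff₀ ha] using huc (t * a) (by positivity))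
    (fun t ht => by simpa only [le_div_iff₀ hb] using hvc (t * b) (by positivity))
    (fun t x y ht hx hy => by
      rw [le_div_iff₀ ha] at hx
      rw [le_div_iff₀ hb] at hy
      rw [le_div_iff₀ hK]
      refine le_trans ?_ (huvh x y)
      calc t * (a ^ c * b ^ d) = (t * a) ^ c * (t * b) ^ d := by
            rw [Real.mul_rpow ht.le ha.le, Real.mul_rpow ht.le hb.le]
            have : t ^ c * t ^ d = t := by rw [← Real.rpow_add ht, hcd, Real.rpow_one]
            linear_combination (-(a ^ c * b ^ d)) * this
        _ ≤ _ := by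
            have := (hu0 x).le
            gcongr)
  rw [← ofReal_integral_eq_lintegral_ofReal (hui.div_const _)
      (ae_of_all _ fun x => (div_pos (hu0 x) ha).le),
    ← ofReal_integral_eq_lintegral_ofReal (hvi.div_const _)
      (ae_of_all _ fun x => (div_pos (hv0 x) hb).le),
    ← ofReal_integral_eq_lintegral_ofReal (hhi.div_const _)
      (ae_of_all _ fun x => div_nonneg (hh0 x) hK.le), integral_div, integral_div, integral_div,
    ← ENNReal.ofReal_mul hc.le, ← ENNReal.ofReal_mul hd.le] at key
  have hU : 0 ≤ ∫ x, u x := integral_nonneg fun x => (hu0 x).le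
  have hV : 0 ≤ ∫ x, v x := integral_nonneg fun x => (hv0 x).le
  have hH : 0 ≤ ∫ x, h x := integral_nonneg hh0
  rw [← ENNReal.ofReal_add (by positivity) (by positivity),
    ENNReal.ofReal_le_ofReal_iff (by positivity)] at key
  have amgm := Real.geom_mean_le_arith_mean2_weighted hc.le hd.le
    (div_nonneg hU ha.le) (div_nonneg hV hb.le) hcd
  rw [Real.div_rpow hU ha.le, Real.div_rpow hV hb.le, div_mul_div_comm] at amgm
  exact (div_le_div_iff_of_pos_right hK).1 (amgm.trans key)

/-! ### A transport inequality for the Gaussian measure -/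

theorem abs_le_of_lipschitz {E : Type*} [SeminormedAddCommGroup E] {f : E → ℝ} {K : ℝ≥0}
    (hf : LipschitzWith K f) (x : E) : |f x| ≤ |f 0| + K * ‖x‖ := by
  have := hf.dist_le_mul x 0
  rw [Real.dist_eq, dist_zero_right] at this
  have := abs_sub_abs_le_abs_sub (f x) (f 0)
  linarith

theorem integrable_exp_mul_abs_gaussianReal (K : ℝ) :
    Integrable (fun x => Real.exp (K * |x|)) (gaussianReal 0 1) := by
  refine Integrable.mono' ((integrable_exp_mul_gaussianReal (μ := 0) (v := 1) K).add
    (integrable_exp_mul_gaussianReal (μ := 0) (v := 1) (-K))) (by fun_prop) (ae_of_all _ fun x => ?_)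
  rw [Real.norm_of_nonneg (Real.exp_pos _).le, Pi.add_apply]
  rcases abs_cases x with ⟨h, _⟩ | ⟨h, _⟩
  · rw [h]; have := Real.exp_pos (-K * x); linarith
  · rw [h, mul_neg, ← neg_mul]; have := Real.exp_pos (K * x); linarith

theorem integrable_exp_of_lipschitz_pi {n : ℕ} {f : (Fin n → ℝ) → ℝ} {K : ℝ≥0}
    (hf : LipschitzWith K f) :
    Integrable (fun x => Real.exp (f x)) (Measure.pi fun _ : Fin n => gaussianReal 0 1) := by
  have hprod : Integrable (fun x : Fin n → ℝ => ∏ i, Real.exp (K * |x i|))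
      (Measure.pi fun _ : Fin n => gaussianReal 0 1) :=
    Integrable.fintype_prod (f := fun _ x => Real.exp (K * |x|))
      fun _ => integrable_exp_mul_abs_gaussianReal K
  refine Integrable.mono' (hprod.const_mul (Real.exp |f 0|))
    (Real.continuous_exp.comp hf.continuous).aestronglyMeasurable (ae_of_all _ fun x => ?_)
  rw [Real.norm_of_nonneg (Real.exp_pos _).le, ← Real.exp_sum, ← Real.exp_add, ← Finset.mul_sum]
  apply Real.exp_le_exp.2
  have h1 := abs_le_of_lipschitz hf x
  have h2 : ‖x‖ ≤ ∑ i, |x i| := by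
    refine (pi_norm_le_iff_of_nonneg (by positivity)).2 fun i => ?_
    exact Finset.single_le_sum (f := fun i => |x i|) (fun _ _ => abs_nonneg _) (Finset.mem_univ i)
  have h3 := le_abs_self (f x)
  have h4 := mul_le_mul_of_nonneg_left h2 K.coe_nonneg
  linarith

theorem integrable_of_integrable_exp {α : Type*} [MeasurableSpace α] {μ : Measure α} {f : α → ℝ}
    (hf : AEStronglyMeasurable f μ) (h : Integrable (fun x => Real.exp (f x)) μ)
    (h' : Integrable (fun x => Real.exp (-f x)) μ) : Integrable f μ := by
  refine Integrable.mono' (h.add h') hf (ae_of_all _ fun x => ?_)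
  rw [Real.norm_eq_abs, Pi.add_apply]
  have h1 := Real.add_one_le_exp (f x)
  have h2 := Real.add_one_le_exp (-f x)
  have h3 := Real.exp_pos (f x)
  have h4 := Real.exp_pos (-f x)
  rcases abs_cases (f x) with ⟨h, _⟩ | ⟨h, _⟩ <;> linarith

theorem integrable_of_lipschitz_pi {n : ℕ} {f : (Fin n → ℝ) → ℝ} {K : ℝ≥0}
    (hf : LipschitzWith K f) : Integrable f (Measure.pi fun _ : Fin n => gaussianReal 0 1) :=
  integrable_of_integrable_exp hf.continuous.aestronglyMeasurable
    (integrable_exp_of_lipschitz_pi hf) (integrable_exp_of_lipschitz_pi hf.neg)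

theorem integrable_exp_of_lipschitz_gaussianReal {f : ℝ → ℝ} {K : ℝ≥0} (hf : LipschitzWith K f) :
    Integrable (fun x => Real.exp (f x)) (gaussianReal 0 1) := by
  refine Integrable.mono' ((integrable_exp_mul_abs_gaussianReal K).const_mul (Real.exp |f 0|))
    (Real.continuous_exp.comp hf.continuous).aestronglyMeasurable (ae_of_all _ fun x => ?_)
  rw [Real.norm_of_nonneg (Real.exp_pos _).le, ← Real.exp_add]
  exact Real.exp_le_exp.2 ((le_abs_self _).trans (abs_le_of_lipschitz hf x))

theorem integrable_of_lipschitz_gaussianReal {f : ℝ → ℝ} {K : ℝ≥0} (hf : LipschitzWith K f) :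
    Integrable f (gaussianReal 0 1) :=
  integrable_of_integrable_exp hf.continuous.aestronglyMeasurable
    (integrable_exp_of_lipschitz_gaussianReal hf) (integrable_exp_of_lipschitz_gaussianReal hf.neg)

theorem gaussianPDFReal_zero_one (x : ℝ) :
    gaussianPDFReal 0 1 x = (√(2 * Real.pi))⁻¹ * Real.exp (-x ^ 2 / 2) := by
  simp [gaussianPDFReal]

theorem isCompact_superlevel_exp_mul_gaussianPDFReal {f : ℝ → ℝ} {K : ℝ≥0}
    (hf : LipschitzWith K f) {t : ℝ} (ht : 0 < t) :
    IsCompact {x | t ≤ Real.exp (f x) * gaussianPDFReal 0 1 x} := by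
  simp only [gaussianPDFReal_zero_one]
  have hcont : Continuous fun x => Real.exp (f x) * ((√(2 * Real.pi))⁻¹ * Real.exp (-x ^ 2 / 2)) := by
    have := hf.continuous
    fun_prop
  refine Metric.isCompact_of_isClosed_isBounded (isClosed_le continuous_const hcont) ?_
  set D := |f 0| - Real.log (t * √(2 * Real.pi))
  have hpi : 0 < √(2 * Real.pi) := by positivity
  -- Taking logarithms leaves `x²/2 ≤ D + K|x|`, which fails beyond this radius.
  refine (Metric.isBounded_closedBall (x := (0 : ℝ)) (r := 2 * K + 2 * |D| + 1)).subset fun x hx => ?_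
  have h1 : t * √(2 * Real.pi) ≤ Real.exp (f x - x ^ 2 / 2) := by
    have : t ≤ Real.exp (f x) * ((√(2 * Real.pi))⁻¹ * Real.exp (-x ^ 2 / 2)) := hx
    rw [mul_left_comm, ← Real.exp_add, inv_mul_eq_div, le_div_iff₀ hpi] at this
    rwa [neg_div, ← sub_eq_add_neg] at this
  rw [← Real.log_le_iff_le_exp (by positivity)] at h1
  have h2 := (le_abs_self _).trans (abs_le_of_lipschitz hf x)
  rw [Real.norm_eq_abs] at h2
  rw [mem_closedBall_zero_iff, Real.norm_eq_abs]
  by_contra! hlt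
  have h3 : |x| ^ 2 / 2 ≤ D + K * |x| := by rw [sq_abs]; simp only [D]; linarith
  have h4 := le_abs_self D
  have h5 := abs_nonneg D
  have h6 : (0 : ℝ) ≤ K := K.coe_nonneg
  nlinarith

theorem integrable_mul_gaussianPDFReal {f : ℝ → ℝ} (hf : Integrable f (gaussianReal 0 1)) :
    Integrable (fun x => f x * gaussianPDFReal 0 1 x) := by
  rw [gaussianReal_of_var_ne_zero _ one_ne_zero,
    integrable_withDensity_iff (measurable_gaussianPDF 0 1) (ae_of_all _ fun x => by
      simp [gaussianPDF])] at hf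
  simpa [gaussianPDF, ENNReal.toReal_ofReal (gaussianPDFReal_nonneg 0 1 _)] using hf

theorem integral_gaussianReal_eq (f : ℝ → ℝ) :
    ∫ x, f x ∂(gaussianReal 0 1) = ∫ x, f x * gaussianPDFReal 0 1 x := by
  rw [integral_gaussianReal_eq_integral_smul one_ne_zero]
  simp [mul_comm]

/-- An exponential-integral form of Talagrand's transport inequality, on the line. -/
theorem integral_exp_le_exp_integral_gaussianReal {φ ψ : ℝ → ℝ} {K : ℝ≥0} {κ : ℝ}
    (hκ : 0 < κ) (hκ1 : κ < 1) (hφ : LipschitzWith K φ) (hψ : LipschitzWith K ψ)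
    (h : ∀ x y, ψ x ≤ φ y + κ / 2 * (x - y) ^ 2) :
    ∫ x, Real.exp (ψ x) ∂(gaussianReal 0 1) ≤ Real.exp (∫ x, φ x ∂(gaussianReal 0 1)) := by
  -- With `mκ = 1 - κ`, the weights `1 - κ` on `ψ` and `κ` on `-mφ` balance, and the Gaussian
  -- exponents differ by exactly `κ(1-κ)(x-y)²/2`, matching the assumed cost.
  set m := (1 - κ) / κ with hm
  have hm0 : 0 < m := div_pos (by linarith) hκ
  have hmκ : m * κ = 1 - κ := by rw [hm]; field_simp
  have hφ' : LipschitzWith (‖-m‖₊ * K) fun x => -m * φ x := by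
    exact (lipschitzWith_smul (-m)).comp hφ
  have hpdf := fun x => gaussianPDFReal_pos 0 1 x one_ne_zero
  have hpdfc : Continuous (gaussianPDFReal 0 1) := by
    simp only [funext gaussianPDFReal_zero_one]; fun_prop
  have PL := rpow_integral_mul_rpow_integral_le
    (u := fun x => Real.exp (ψ x) * gaussianPDFReal 0 1 x)
    (v := fun x => Real.exp (-m * φ x) * gaussianPDFReal 0 1 x) (h := gaussianPDFReal 0 1)
    (c := 1 - κ) (d := κ) (by linarith) hκ (by ring)
    (fun x => mul_pos (Real.exp_pos _) (hpdf x)) (fun x => mul_pos (Real.exp_pos _) (hpdf x))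
    (fun x => (hpdf x).le) ((Real.continuous_exp.comp hψ.continuous).mul hpdfc)
    ((Real.continuous_exp.comp hφ'.continuous).mul hpdfc) (measurable_gaussianPDFReal 0 1)
    (fun t ht => isCompact_superlevel_exp_mul_gaussianPDFReal hψ ht)
    (fun t ht => isCompact_superlevel_exp_mul_gaussianPDFReal hφ' ht)
    (integrable_mul_gaussianPDFReal (integrable_exp_of_lipschitz_gaussianReal hψ))
    (integrable_mul_gaussianPDFReal (integrable_exp_of_lipschitz_gaussianReal hφ'))
    (integrable_gaussianPDFReal 0 1) (fun x y => ?_)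
  · rw [← integral_gaussianReal_eq, ← integral_gaussianReal_eq,
      integral_gaussianPDFReal_eq_one _ one_ne_zero] at PL
    have hi := integrable_exp_of_lipschitz_gaussianReal hφ'
    have jensen : Real.exp (∫ x, -m * φ x ∂(gaussianReal 0 1)) ≤
        ∫ x, Real.exp (-m * φ x) ∂(gaussianReal 0 1) :=
      convexOn_exp.map_integral_le Real.continuous_exp.continuousOn isClosed_univ (by simp)
        (integrable_of_lipschitz_gaussianReal hφ') hi
    rw [integral_const_mul] at jensen
    set I := ∫ x, Real.exp (ψ x) ∂(gaussianReal 0 1)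
    set J := ∫ x, φ x ∂(gaussianReal 0 1)
    have hI : 0 ≤ I := integral_nonneg fun x => (Real.exp_pos _).le
    have h1 : I ^ (1 - κ) * Real.exp (-m * J) ^ κ ≤ 1 := by
      refine le_trans ?_ PL
      gcongr
    rw [← Real.exp_mul, show -m * J * κ = -((1 - κ) * J) by rw [← hmκ]; ring, Real.exp_neg,
      ← div_eq_mul_inv, div_le_one (Real.exp_pos _), mul_comm, Real.exp_mul] at h1
    exact (Real.rpow_le_rpow_iff hI (Real.exp_pos _).le (by linarith)).1 h1
  · have hpi : 0 < (√(2 * Real.pi))⁻¹ := by positivity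
    simp only [gaussianPDFReal_zero_one]
    set c := (√(2 * Real.pi))⁻¹
    rw [mul_left_comm, mul_left_comm (Real.exp (-m * φ y)), ← Real.exp_add, ← Real.exp_add,
      Real.mul_rpow hpi.le (Real.exp_pos _).le, Real.mul_rpow hpi.le (Real.exp_pos _).le,
      mul_mul_mul_comm, ← Real.rpow_add hpi, sub_add_cancel, Real.rpow_one, ← Real.exp_mul,
      ← Real.exp_mul, ← Real.exp_add]
    refine mul_le_mul_of_nonneg_left (Real.exp_le_exp.2 ?_) hpi.le
    have h1 : (-m * φ y + -y ^ 2 / 2) * κ = -(1 - κ) * φ y - κ * y ^ 2 / 2 := by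
      rw [← hmκ]; ring
    rw [h1]
    have h2 := mul_le_mul_of_nonneg_left (h x y) (by linarith : 0 ≤ 1 - κ)
    nlinarith

theorem lipschitzWith_comp_cons_left {n : ℕ} {f : (Fin (n + 1) → ℝ) → ℝ} {K : ℝ≥0}
    (hf : LipschitzWith K f) (x : Fin n → ℝ) : LipschitzWith K fun a : ℝ => f (Fin.cons a x) := by
  refine LipschitzWith.of_dist_le_mul fun a b => (hf.dist_le_mul _ _).trans ?_
  refine mul_le_mul_of_nonneg_left ((dist_pi_le_iff dist_nonneg).2 fun i => ?_) K.coe_nonneg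
  refine Fin.cases ?_ (fun j => ?_) i <;> simp

theorem lipschitzWith_comp_cons_right {n : ℕ} {f : (Fin (n + 1) → ℝ) → ℝ} {K : ℝ≥0}
    (hf : LipschitzWith K f) (a : ℝ) : LipschitzWith K fun x : Fin n → ℝ => f (Fin.cons a x) := by
  refine LipschitzWith.of_dist_le_mul fun x y => (hf.dist_le_mul _ _).trans ?_
  refine mul_le_mul_of_nonneg_left ((dist_pi_le_iff dist_nonneg).2 fun i => ?_) K.coe_nonneg
  refine Fin.cases ?_ (fun j => ?_) i
  · simp
  · simpa using dist_le_pi_dist x y j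

theorem integral_pi_succ {n : ℕ} {f : (Fin (n + 1) → ℝ) → ℝ}
    (hf : Integrable f (Measure.pi fun _ : Fin (n + 1) => gaussianReal 0 1)) :
    ∫ x, f x ∂(Measure.pi fun _ : Fin (n + 1) => gaussianReal 0 1) =
      ∫ x, ∫ a, f (Fin.cons a x) ∂(gaussianReal 0 1)
        ∂(Measure.pi fun _ : Fin n => gaussianReal 0 1) := by
  have e := (measurePreserving_piFinSuccAbove (fun _ : Fin (n + 1) => gaussianReal 0 1) 0).symm
  rw [← e.integral_comp' (g := f), integral_prod_symm]
  · simp [MeasurableEquiv.piFinSuccAbove, Fin.insertNthEquiv]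
  · exact (e.integrable_comp_emb (MeasurableEquiv.measurableEmbedding _)).2 hf

/-- An exponential-integral form of Talagrand's transport inequality for the standard Gaussian
measure on `ℝⁿ`. -/
theorem integral_exp_le_exp_integral_pi {κ : ℝ} (hκ : 0 < κ) (hκ1 : κ < 1) {n : ℕ} {K : ℝ≥0} :
    ∀ {φ ψ : (Fin n → ℝ) → ℝ}, LipschitzWith K φ → LipschitzWith K ψ →
      (∀ x y, ψ x ≤ φ y + κ / 2 * ∑ i, (x i - y i) ^ 2) →
      ∫ x, Real.exp (ψ x) ∂(Measure.pi fun _ : Fin n => gaussianReal 0 1) ≤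
        Real.exp (∫ x, φ x ∂(Measure.pi fun _ : Fin n => gaussianReal 0 1)) := by
  induction n with
  | zero =>
    intro φ ψ _ _ h
    have h0 := h 0 0
    simp only [Finset.univ_eq_empty, Finset.sum_empty, mul_zero, add_zero] at h0
    have : ∀ f : (Fin 0 → ℝ) → ℝ,
        ∫ x, f x ∂(Measure.pi fun _ : Fin 0 => gaussianReal 0 1) = f 0 := fun f => by
      rw [show f = fun _ => f 0 from funext fun x => congrArg f (Subsingleton.elim _ _)]
      simp
    rw [this, this]
    exact Real.exp_le_exp.2 h0
  | succ n ih =>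
    intro φ ψ hφ hψ h
    set γ := gaussianReal 0 1
    have hφi := fun x => integrable_of_lipschitz_gaussianReal (lipschitzWith_comp_cons_left hφ x)
    have hψi := fun x => integrable_exp_of_lipschitz_gaussianReal (lipschitzWith_comp_cons_left hψ x)
    set Φ : (Fin n → ℝ) → ℝ := fun x => ∫ a, φ (Fin.cons a x) ∂γ with hΦ
    set I : (Fin n → ℝ) → ℝ := fun x => ∫ a, Real.exp (ψ (Fin.cons a x)) ∂γ with hI
    have hI0 : ∀ x, 0 < I x := fun x => integral_exp_pos (hψi x)
    have hexp : ∀ x, Real.exp (Real.log (I x)) = I x := fun x => Real.exp_log (hI0 x)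
    rw [integral_pi_succ (integrable_exp_of_lipschitz_pi hψ),
      integral_pi_succ (integrable_of_lipschitz_pi hφ)]
    change ∫ x, I x ∂_ ≤ Real.exp (∫ x, Φ x ∂_)
    refine (integral_congr_ae (ae_of_all _ fun x => (hexp x).symm)).trans_le ?_
    -- The induction hypothesis is applied to `Φ` and `log I`. Both inherit the constant `K`, which
    -- serves only for integrability and never enters the estimate.
    refine ih ?_ ?_ ?_
    · refine LipschitzWith.of_le_add_mul K fun x y => ?_
      calc Φ x ≤ ∫ a, (φ (Fin.cons a y) + K * dist x y) ∂γ := by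
            refine integral_mono (hφi x) ((hφi y).add (integrable_const _)) fun a => ?_
            have := (lipschitzWith_comp_cons_right hφ a).dist_le_mul x y
            have := (abs_le.1 this).2
            change φ (Fin.cons a x) ≤ φ (Fin.cons a y) + K * dist x y
            linarith
        _ = Φ y + K * dist x y := by
            rw [integral_add (hφi y) (integrable_const _)]; simp [hΦ, γ]
    · refine LipschitzWith.of_le_add_mul K fun x y => ?_
      rw [← Real.log_exp (K * dist x y), ← Real.log_mul (hI0 y).ne' (Real.exp_pos _).ne']
      refine Real.log_le_log (hI0 x) ?_
      rw [hI, ← integral_mul_const]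
      refine integral_mono (hψi x) ((hψi y).mul_const _) fun a => ?_
      have := (lipschitzWith_comp_cons_right hψ a).dist_le_mul x y
      have := (abs_le.1 this).2
      change Real.exp (ψ (Fin.cons a x)) ≤ Real.exp (ψ (Fin.cons a y)) * Real.exp (K * dist x y)
      rw [← Real.exp_add]
      exact Real.exp_le_exp.2 (by linarith)
    · intro x y
      set D := κ / 2 * ∑ i, (x i - y i) ^ 2
      -- The cost of the tail coordinates is a constant for the one-dimensional inequality in the
      -- first coordinate.
      have hφD : LipschitzWith K fun a => φ (Fin.cons a y) + D :=
        by simpa using (lipschitzWith_comp_cons_left hφ y).add (LipschitzWith.const D)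
      have key := integral_exp_le_exp_integral_gaussianReal hκ hκ1 hφD
        (lipschitzWith_comp_cons_left hψ x) fun a b => by
          have := h (Fin.cons a x) (Fin.cons b y)
          rw [Fin.sum_univ_succ] at this
          simp only [Fin.cons_zero, Fin.cons_succ] at this
          simp only [D]
          linarith
      rw [integral_add (hφi y) (integrable_const _)] at key
      rw [Real.log_le_iff_le_exp (hI0 x)]
      simpa [hI, hΦ] using key

/-! ### Concentration of Lipschitz functions -/

theorem integral_stdGaussian_eq {p : ℕ} {F : Vec p → ℝ} (hF : Continuous F) :
    ∫ x, F x ∂(stdGaussian (Vec p)) =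
      ∫ x, F (WithLp.toLp 2 x) ∂(Measure.pi fun _ : Fin p => gaussianReal 0 1) := by
  rw [← map_pi_eq_stdGaussian, integral_map (by fun_prop) hF.aestronglyMeasurable]

theorem lipschitzWith_comp_toLp {p : ℕ} {F : Vec p → ℝ} {K : ℝ≥0} (hF : LipschitzWith K F) :
    ∃ K' : ℝ≥0, LipschitzWith K' fun x : Fin p → ℝ => F (WithLp.toLp 2 x) :=
  ⟨_, hF.comp (PiLp.lipschitzWith_toLp 2 _)⟩

theorem integrable_exp_of_lipschitz_stdGaussian {p : ℕ} {F : Vec p → ℝ} {K : ℝ≥0}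
    (hF : LipschitzWith K F) : Integrable (fun x => Real.exp (F x)) (stdGaussian (Vec p)) := by
  obtain ⟨K', hK'⟩ := lipschitzWith_comp_toLp hF
  have hF' := hF.continuous
  have hm : AEStronglyMeasurable (fun x => Real.exp (F x)) (stdGaussian (Vec p)) :=
    (Real.continuous_exp.comp hF').aestronglyMeasurable
  rw [← map_pi_eq_stdGaussian] at hm ⊢
  rw [integrable_map_measure hm (by fun_prop)]
  exact integrable_exp_of_lipschitz_pi hK'

/-- The transport inequality is used with `φ = tF` and `ψ = tF - t²/(2κ)`; its hypothesis is Young's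
inequality `|t| d ≤ t²/(2κ) + κd²/2`. -/
theorem mgf_stdGaussian_le {p : ℕ} {F : Vec p → ℝ} (hF : LipschitzWith 1 F) {κ : ℝ} (hκ : 0 < κ)
    (hκ1 : κ < 1) (t : ℝ) :
    mgf F (stdGaussian (Vec p)) t ≤
      Real.exp (t * (∫ x, F x ∂(stdGaussian (Vec p))) + t ^ 2 / (2 * κ)) := by
  have htF : LipschitzWith (‖t‖₊ * 1) fun x => t * F x := (lipschitzWith_smul t).comp hF
  obtain ⟨K, hK⟩ := lipschitzWith_comp_toLp htF
  have hψ : LipschitzWith K fun x : Fin p → ℝ => t * F (WithLp.toLp 2 x) + -(t ^ 2 / (2 * κ)) :=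
    by simpa using hK.add (LipschitzWith.const (-(t ^ 2 / (2 * κ))))
  have key := integral_exp_le_exp_integral_pi hκ hκ1 hK hψ fun x y => ?_
  · simp only [Real.exp_add] at key
    rw [integral_mul_const, Real.exp_neg, ← div_eq_mul_inv, div_le_iff₀ (Real.exp_pos _),
      ← Real.exp_add, integral_const_mul] at key
    rw [mgf, integral_stdGaussian_eq (F := fun x => Real.exp (t * F x))
        (Real.continuous_exp.comp htF.continuous),
      integral_stdGaussian_eq hF.continuous]
    exact key
  · have h1 : F (WithLp.toLp 2 x) - F (WithLp.toLp 2 y) ∈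
        Icc (-dist (WithLp.toLp 2 x) (WithLp.toLp 2 y)) (dist (WithLp.toLp 2 x) (WithLp.toLp 2 y)) := by
      have := hF.dist_le_mul (WithLp.toLp 2 x) (WithLp.toLp 2 y)
      rw [NNReal.coe_one, one_mul] at this
      exact abs_le.1 this
    have h2 : ∑ i, (x i - y i) ^ 2 = dist (WithLp.toLp 2 x) (WithLp.toLp 2 y) ^ 2 := by
      rw [dist_eq_norm, EuclideanSpace.real_norm_sq_eq]
      simp
    rw [h2]
    set d := dist (WithLp.toLp 2 x) (WithLp.toLp 2 y)
    have h3 : t * F (WithLp.toLp 2 x) - t * F (WithLp.toLp 2 y) ≤ |t| * d := by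
      rw [← mul_sub]
      refine (le_abs_self _).trans ?_
      rw [abs_mul]
      exact mul_le_mul_of_nonneg_left (abs_le.2 h1) (abs_nonneg t)
    have h4 : |t| * d ≤ t ^ 2 / (2 * κ) + κ / 2 * d ^ 2 := by
      rw [← sq_abs t]
      have : t ^ 2 / (2 * κ) + κ / 2 * d ^ 2 - |t| * d = (|t| - κ * d) ^ 2 / (2 * κ) := by
        rw [← sq_abs t]; field_simp; ring
      have h5 : 0 ≤ (|t| - κ * d) ^ 2 / (2 * κ) := by positivity
      rw [← sq_abs t] at this
      linarith
    linarith

/-- Gaussian concentration for a `1`-Lipschitz function, with the optimal constant. -/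
theorem stdGaussian_real_ge_le_exp {p : ℕ} {F : Vec p → ℝ} (hF : LipschitzWith 1 F) {s : ℝ}
    (hs : 0 ≤ s) :
    (stdGaussian (Vec p)).real {x | (∫ x, F x ∂(stdGaussian (Vec p))) + s ≤ F x} ≤
      Real.exp (-s ^ 2 / 2) := by
  set m := ∫ x, F x ∂(stdGaussian (Vec p))
  have hκ : ∀ κ ∈ Ioo (0 : ℝ) 1, (stdGaussian (Vec p)).real {x | m + s ≤ F x} ≤
      Real.exp (-(κ * s ^ 2) / 2) := fun κ hκ => by
    have hi : Integrable (fun x => Real.exp (κ * s * F x)) (stdGaussian (Vec p)) :=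
      integrable_exp_of_lipschitz_stdGaussian ((lipschitzWith_smul (κ * s)).comp hF)
    -- The Chernoff exponent `κs` is optimal for this bound; the sharp constant appears as `κ` tends
    -- to 1.
    refine (measure_ge_le_exp_mul_mgf (m + s) (mul_nonneg hκ.1.le hs) hi).trans ?_
    refine (mul_le_mul_of_nonneg_left (mgf_stdGaussian_le hF hκ.1 hκ.2 (κ * s))
      (Real.exp_pos _).le).trans_eq ?_
    rw [← Real.exp_add]
    congr 1
    have := hκ.1.ne'
    field_simp
    ring
  have hlim : Tendsto (fun κ : ℝ => Real.exp (-(κ * s ^ 2) / 2)) (𝓝[<] 1)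
      (𝓝 (Real.exp (-s ^ 2 / 2))) := by
    have : Continuous fun κ : ℝ => Real.exp (-(κ * s ^ 2) / 2) := by fun_prop
    simpa using (this.tendsto 1).mono_left nhdsWithin_le_nhds
  exact ge_of_tendsto hlim (mem_of_superset (Ioo_mem_nhdsLT zero_lt_one) hκ)

/-! ### The proximal denoiser -/

section Prox

variable {p : ℕ} {C : Set (Vec p)}

/-- Hahn–Banach: extend `c x ↦ c ‖x‖_C` from the line through `x`, dominated by the gauge. Needed
because `infDist` to the empty set is 0, which would make the error bound false. -/
theorem subdiff_gauge_nonempty (hC : Convex ℝ C) (hC0 : C ∈ 𝓝 (0 : Vec p)) (x : Vec p) :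
    (subdiff (gauge C) x).Nonempty := by
  rcases eq_or_ne x 0 with rfl | hx
  · exact ⟨0, fun z => by simpa using gauge_nonneg z⟩
  obtain ⟨g, hg, hgN⟩ := exists_extension_of_le_sublinear
    (LinearPMap.mkSpanSingleton x (gauge C x) hx) (gauge C)
    (fun c hc x => gauge_smul_of_nonneg hc.le x) (gauge_add_le hC (absorbent_nhds_zero hC0)) (by
      rintro ⟨y, hy⟩
      obtain ⟨c, rfl⟩ := Submodule.mem_span_singleton.1 hy
      refine (LinearPMap.mkSpanSingleton'_apply x (gauge C x) _ c hy).trans_le ?_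
      rcases le_total 0 c with hc | hc
      · exact (gauge_smul_of_nonneg hc x).ge
      · exact (mul_nonpos_of_nonpos_of_nonneg hc (gauge_nonneg x)).trans (gauge_nonneg _))
  have hgx : g x = gauge C x := by
    have := hg ⟨x, Submodule.mem_span_singleton_self x⟩
    rw [LinearPMap.mkSpanSingleton_apply] at this
    exact this
  refine ⟨(InnerProductSpace.toDual ℝ (Vec p)).symm (LinearMap.toContinuousLinearMap g),
    fun z => ?_⟩
  rw [InnerProductSpace.toDual_symm_apply]
  simpa [hgx] using hgN z

theorem isProx_prox (hC : Convex ℝ C) (hC0 : C ∈ 𝓝 (0 : Vec p)) {l : ℝ} (hl : 0 ≤ l) (y : Vec p) :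
    IsProx C l y (prox C l y) := by
  refine Classical.epsilon_spec (p := IsProx C l y) ?_
  have hc : Continuous fun x => (1 / 2) * ‖y - x‖ ^ 2 + l * gauge C x := by
    have := continuous_gauge hC hC0
    fun_prop
  refine hc.exists_forall_le' y ?_
  have hlim : Tendsto (fun x : Vec p => ‖y - x‖) (cocompact (Vec p)) atTop := by
    refine tendsto_atTop_mono (fun x => ?_)
      (tendsto_atTop_add_const_right _ (-‖y‖) (tendsto_norm_cocompact_atTop (E := Vec p)))
    have := norm_sub_norm_le x y
    rw [norm_sub_rev] at this
    linarith
  -- At `x = y` the objective is `L = l * gauge C y`, and `(2L + 1)²/2 ≥ L`.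
  filter_upwards [hlim.eventually_ge_atTop (2 * (l * gauge C y) + 1)] with x hx
  have h1 : 0 ≤ l * gauge C y := mul_nonneg hl (gauge_nonneg y)
  have h2 : 0 ≤ l * gauge C x := mul_nonneg hl (gauge_nonneg x)
  rw [sub_self, norm_zero]
  nlinarith

/-- Optimality of `x'` along the segment towards `x`, added to the subgradient inequality at `x`,
gives `⟨y - x - l w, h⟩ + ‖h‖² ≤ 0` for `h = x - x'`; then Cauchy–Schwarz. -/
theorem norm_sub_le_of_isProx (hC : Convex ℝ C) (hC0 : C ∈ 𝓝 (0 : Vec p)) {l : ℝ} (hl : 0 ≤ l)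
    {x x' y w : Vec p} (hx' : IsProx C l y x') (hw : w ∈ subdiff (gauge C) x) :
    ‖x' - x‖ ≤ ‖y - x - l • w‖ := by
  set h := x - x' with hh
  have step : ∀ s ∈ Ioc (0 : ℝ) 1,
      inner ℝ (y - x') h - l * (gauge C x - gauge C x') ≤ s / 2 * ‖h‖ ^ 2 := fun s hs => by
    have h1 := hx' (x' + s • h)
    have h2 : gauge C (x' + s • h) ≤ (1 - s) * gauge C x' + s * gauge C x := by
      rw [show x' + s • h = (1 - s) • x' + s • x by rw [hh]; module,
        ← smul_eq_mul, ← smul_eq_mul, ← gauge_smul_of_nonneg (sub_nonneg.2 hs.2),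
        ← gauge_smul_of_nonneg hs.1.le]
      exact gauge_add_le hC (absorbent_nhds_zero hC0) _ _
    have h3 : ‖y - (x' + s • h)‖ ^ 2 =
        ‖y - x'‖ ^ 2 - 2 * (s * inner ℝ (y - x') h) + s ^ 2 * ‖h‖ ^ 2 := by
      rw [← sub_sub, norm_sub_sq_real, inner_smul_right, norm_smul, Real.norm_eq_abs, mul_pow,
        sq_abs]
    rw [h3] at h1
    have h4 := mul_le_mul_of_nonneg_left h2 hl
    have h5 : s * (inner ℝ (y - x') h - l * (gauge C x - gauge C x')) ≤ s * (s / 2 * ‖h‖ ^ 2) := by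
      linarith
    exact le_of_mul_le_mul_left h5 hs.1
  have hopt : inner ℝ (y - x') h - l * (gauge C x - gauge C x') ≤ 0 := by
    by_contra! hA
    set A := inner ℝ (y - x') h - l * (gauge C x - gauge C x')
    have hH : 0 ≤ ‖h‖ ^ 2 := sq_nonneg _
    have hAH : 0 < A + ‖h‖ ^ 2 := by linarith
    -- An explicit small step replaces the limit `s → 0`: here `s‖h‖²/2 < A`.
    have := step (A / (A + ‖h‖ ^ 2)) ⟨div_pos hA hAH, (div_le_one hAH).2 (by linarith)⟩
    rw [div_div, div_mul_eq_mul_div, le_div_iff₀ (by positivity)] at this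
    nlinarith
  have hsub := mul_le_mul_of_nonneg_left (hw x') hl
  have hin : inner ℝ (y - x - l • w) h + ‖h‖ ^ 2 ≤ 0 := by
    have h1 : inner ℝ w (x' - x) = -inner ℝ w h := by rw [← inner_neg_right]; congr 1; simp [hh]
    have h2 : inner ℝ (y - x') h = inner ℝ (y - x) h + ‖h‖ ^ 2 := by
      rw [← real_inner_self_eq_norm_sq, ← inner_add_left]; congr 1; simp [hh]
    rw [h1] at hsub
    rw [inner_sub_left, real_inner_smul_left]
    linarith
  have hcs := neg_le_of_abs_le (abs_real_inner_le_norm (y - x - l • w) h)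
  rw [norm_sub_rev x' x, ← hh]
  rcases (norm_nonneg h).eq_or_lt with h0 | h0
  · rw [← h0]; exact norm_nonneg _
  · refine le_of_mul_le_mul_right ?_ h0
    nlinarith

/-- The error of the proximal denoiser is at most the distance from the noise to the scaled
subdifferential. -/
theorem norm_prox_sub_le_infDist (hC : Convex ℝ C) (hC0 : C ∈ 𝓝 (0 : Vec p)) {l : ℝ} (hl : 0 ≤ l)
    (x y : Vec p) : ‖prox C l y - x‖ ≤ Metric.infDist (y - x) (l • subdiff (gauge C) x) := by
  refine (Metric.le_infDist (subdiff_gauge_nonempty hC hC0 x).smul_set).2 ?_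
  rintro _ ⟨w, hw, rfl⟩
  rw [dist_eq_norm]
  exact norm_sub_le_of_isProx hC hC0 hl (isProx_prox hC hC0 hl y) hw

theorem infDist_smul_mul_smul {a : ℝ} (ha : 0 < a) (l : ℝ) (g : Vec p) (S : Set (Vec p)) :
    Metric.infDist (a • g) ((a * l) • S) = a * Metric.infDist g (l • S) := by
  rw [mul_smul, infDist_smul₀ ha.ne', Real.norm_of_nonneg ha.le]

end Prox

/-! ### The Gaussian distance -/

section GaussianDist

variable {p n : ℕ} {C : Set (Vec p)} {X : ℕ → Vec p}

theorem expDist_nonneg (C : Set (Vec p)) (x : Vec p) (l : ℝ) : 0 ≤ expDist C x l :=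
  integral_nonneg fun _ => Metric.infDist_nonneg

theorem gaussianDist_nonneg (C : Set (Vec p)) (n : ℕ) (X : ℕ → Vec p) : 0 ≤ gaussianDist C n X :=
  Real.iInf_nonneg fun _ => Real.iSup_nonneg fun _ => expDist_nonneg C _ _

theorem expDist_le_gaussianDist {l : ℝ} (hl : IsArgmin C n X l) {t : ℕ}
    (ht : t ∈ Finset.Icc 1 n) : expDist C (X t) l ≤ gaussianDist C n X := by
  have h1 : expDist C (X t) l ≤ worstExpDist C n X l :=
    le_ciSup (f := fun t : Finset.Icc 1 n => expDist C (X t) l) (Set.finite_range _).bddAbove ⟨t, ht⟩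
  exact h1.trans (le_ciInf fun l' : Set.Ici (0 : ℝ) => hl.2 l' l'.2)

end GaussianDist

/-! ### Averages of the noise -/

section Noise

variable {Ω : Type*} [MeasurableSpace Ω] {P : Measure Ω} [IsProbabilityMeasure P] {p n : ℕ} {σ : ℝ}
  {ε : ℕ → Ω → Vec p}

/-- By independence the characteristic function is a product of `|I|` equal factors
`exp(-σ²‖x‖²/(2|I|²))`, which is that of the scaled standard Gaussian. -/
theorem hasLaw_average_noise
    (hε : ∀ t ∈ Finset.Icc 1 n,
      HasLaw (ε t) (multivariateGaussian 0 (σ ^ 2 • (1 : Matrix (Fin p) (Fin p) ℝ))) P)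
    (hindep : iIndepFun (fun t : Finset.Icc 1 n => ε t) P) {I : Finset ℕ}
    (hI : I ⊆ Finset.Icc 1 n) (hI0 : I.Nonempty) :
    HasLaw (fun ω => (1 / (I.card : ℝ)) • ∑ t ∈ I, ε t ω)
      ((stdGaussian (Vec p)).map fun g => (σ / √I.card) • g) P := by
  have hm : ∀ t ∈ I, AEMeasurable (ε t) P := fun t ht => (hε t (hI ht)).aemeasurable
  have hsum : AEMeasurable (fun ω => ∑ t ∈ I, ε t ω) P := Finset.aemeasurable_fun_sum I hm
  have hind : iIndepFun (I.restrict ε) P :=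
    hindep.precomp (g := fun t : I => (⟨t, hI t.2⟩ : Finset.Icc 1 n)) fun a b hab =>
      Subtype.ext (congrArg (fun t : Finset.Icc 1 n => (t : ℕ)) hab)
  have hmean : AEMeasurable (fun ω => (1 / (I.card : ℝ)) • ∑ t ∈ I, ε t ω) P :=
    hsum.const_smul (1 / (I.card : ℝ))
  have hprob : IsProbabilityMeasure ((stdGaussian (Vec p)).map fun g => (σ / √I.card) • g) :=
    Measure.isProbabilityMeasure_map (by fun_prop)
  have hprob' : IsProbabilityMeasure (P.map fun ω => (1 / (I.card : ℝ)) • ∑ t ∈ I, ε t ω) :=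
    Measure.isProbabilityMeasure_map hmean
  refine ⟨hmean, Measure.ext_of_charFun (funext fun x => ?_)⟩
  have hS : (σ ^ 2 • (1 : Matrix (Fin p) (Fin p) ℝ)).PosSemidef :=
    Matrix.PosSemidef.one.smul (sq_nonneg σ)
  have hc : (I.card : ℝ) ≠ 0 := by exact_mod_cast hI0.card_pos.ne'
  have hone : ∀ t ∈ I, charFun (P.map (ε t)) ((1 / (I.card : ℝ)) • x) =
      Complex.exp ((-(σ ^ 2 * ‖x‖ ^ 2 / I.card ^ 2) / 2 : ℝ)) := fun t ht => by
    rw [(hε t (hI ht)).map_eq, charFun_multivariateGaussian hS]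
    have : (((1 / (I.card : ℝ)) • x : Vec p) : Fin p → ℝ) ⬝ᵥ
        (σ ^ 2 • (1 : Matrix (Fin p) (Fin p) ℝ)).mulVec ((1 / (I.card : ℝ)) • x : Vec p) =
        σ ^ 2 * ‖x‖ ^ 2 / I.card ^ 2 := by
      rw [Matrix.smul_mulVec, Matrix.one_mulVec, dotProduct_smul, EuclideanSpace.real_norm_sq_eq]
      simp only [dotProduct, PiLp.smul_apply, smul_eq_mul]
      rw [mul_div_assoc, Finset.sum_div]
      congr 1
      refine Finset.sum_congr rfl fun i _ => ?_
      field_simp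
    rw [this, inner_zero_right]
    push_cast
    ring_nf
  rw [charFun_map_smul_comp hsum, hind.charFun_map_fun_finsetSum_eq_prod hm, Finset.prod_apply,
    Finset.prod_congr rfl hone, Finset.prod_const, ← Complex.exp_nat_mul, charFun_map_smul,
    charFun_stdGaussian, norm_smul, ← Complex.ofReal_pow, mul_pow, Real.norm_eq_abs, sq_abs, div_pow,
    Real.sq_sqrt (Nat.cast_nonneg _)]
  congr 1
  have hc' : (I.card : ℂ) ≠ 0 := by exact_mod_cast hI0.card_pos.ne'
  push_cast
  field_simp

/-- The tail of the distance from an average of the noise to a scaled set. -/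
theorem measureReal_infDist_average_noise_ge_le (hσ : 0 < σ)
    (hε : ∀ t ∈ Finset.Icc 1 n,
      HasLaw (ε t) (multivariateGaussian 0 (σ ^ 2 • (1 : Matrix (Fin p) (Fin p) ℝ))) P)
    (hindep : iIndepFun (fun t : Finset.Icc 1 n => ε t) P) {I : Finset ℕ}
    (hI : I ⊆ Finset.Icc 1 n) (hI0 : I.Nonempty) (S : Set (Vec p)) {l η s : ℝ} (hs : 0 ≤ s)
    (hη : ∫ g, Metric.infDist g (l • S) ∂(stdGaussian (Vec p)) ≤ η) :
    P.real {ω | σ / √I.card * (η + s) ≤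
      Metric.infDist ((1 / (I.card : ℝ)) • ∑ t ∈ I, ε t ω) ((σ / √I.card * l) • S)} ≤
      Real.exp (-s ^ 2 / 2) := by
  set a := σ / √I.card
  have ha : 0 < a := div_pos hσ (Real.sqrt_pos.2 (by exact_mod_cast hI0.card_pos))
  have hmeas : MeasurableSet {x : Vec p | a * (η + s) ≤ Metric.infDist x ((a * l) • S)} :=
    measurableSet_le measurable_const (Metric.continuous_infDist_pt _).measurable
  rw [(hasLaw_average_noise hε hindep hI hI0).measureReal_eq hmeas,
    map_measureReal_apply (by fun_prop) hmeas]
  refine le_trans (measureReal_mono fun g hg => ?_)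
    (stdGaussian_real_ge_le_exp (Metric.lipschitz_infDist_pt (l • S)) hs)
  have hg' : a * (η + s) ≤ Metric.infDist (a • g) ((a * l) • S) := hg
  rw [infDist_smul_mul_smul ha] at hg'
  have := le_of_mul_le_mul_left hg' ha
  simp only [mem_ofPred_eq]
  linarith

end Noise

/-! ### Change-points and groups -/

section Groups

variable {p n : ℕ} {X : ℕ → Vec p}

/-- A change-point `c` separates `c` from `c + 1`, so one at `b` itself is harmless. -/
theorem eq_of_forall_notMem_changePoints {a b : ℕ} (ha : 1 ≤ a) (hb : b ≤ n)
    (h : ∀ c ∈ changePoints n X, a ≤ c → b ≤ c) {t : ℕ} (hat : a ≤ t) (htb : t ≤ b) :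
    X t = X a := by
  induction t, hat using Nat.le_induction with
  | base => rfl
  | succ t hat ih =>
    rw [← ih (by omega)]
    by_contra hne
    have := h t ⟨by omega, by omega, fun h => hne h.symm⟩ hat
    omega

theorem Tmin_le_sub {a b : ℕ} (ha : a ∈ changePoints n X) (hb : b ∈ changePoints n X)
    (hab : a < b) : a + Tmin n X ≤ b := by
  have : Tmin n X ≤ b - a := Nat.sInf_le ⟨a, ha, b, hb, hab, rfl⟩
  omega

theorem deltaMin_le_norm_sub {c : ℕ} (hc : c ∈ changePoints n X) :
    deltaMin n X ≤ ‖X c - X (c + 1)‖ :=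
  csInf_le ⟨0, by rintro _ ⟨_, _, rfl⟩; exact norm_nonneg _⟩ ⟨c, hc, rfl⟩

variable {θ : ℕ} {S : ℕ → ℝ} {Z : Set ℕ}

/-- A step of length at most `θ` between indices near `c` and near `c'` forces `|c - c'| < 3θ`,
hence `c' = c`: a group never passes from one marked index to another. -/
theorem SameGroup.near (hsep : ∀ a ∈ Z, ∀ b ∈ Z, a < b → a + 4 * θ ≤ b) (hθ : 1 ≤ θ)
    (hoff : ∀ t ∈ nonzeroIdx n θ S, ∃ c ∈ Z, t < c + θ ∧ c < t + θ) {c t : ℕ} (hc : c ∈ Z)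
    (h : SameGroup n θ S c t) : t < c + θ ∧ c < t + θ := by
  induction h with
  | refl => omega
  | tail _ hab ih =>
    obtain ⟨_, hb, h1, h2⟩ := hab
    obtain ⟨c', hc', h3, h4⟩ := hoff _ hb
    rcases lt_trichotomy c c' with h | rfl | h
    · have := hsep c hc c' hc' h
      omega
    · exact ⟨h3, h4⟩
    · have := hsep c' hc' c hc h
      omega

/-- No marked index lies well between two consecutive selected indices. -/
theorem Consecutive.le_add_of_mem (hsep : ∀ a ∈ Z, ∀ b ∈ Z, a < b → a + 4 * θ ≤ b) (hθ : 1 ≤ θ)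
    (hon : ∀ c ∈ Z, c ∈ nonzeroIdx n θ S)
    (hoff : ∀ t ∈ nonzeroIdx n θ S, ∃ c ∈ Z, t < c + θ ∧ c < t + θ) {T : Finset ℕ}
    (hT : IsSelection n θ S T) {a b : ℕ} (hab : Consecutive T a b) {c : ℕ} (hc : c ∈ Z)
    (hac : a + θ + 1 ≤ c) : b - θ ≤ c := by
  obtain ⟨t, ⟨htT, hct⟩, -⟩ := hT.2 c (hon c hc)
  have := hct.near hsep hθ hoff hc
  have := hab.2.2.2 t htT
  omega

end Groups

/-! ### The algorithm when every denoised average is accurate -/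

section Accurate

variable {p n θ : ℕ} {X Y : ℕ → Vec p} {C : Set (Vec p)} {γ l : ℝ}

/-- Every window of length `θ` in `{1, …, n}` on which the signal is constant is denoised with an
error of less than `δ`. -/
def AccurateWindows (C : Set (Vec p)) (n θ : ℕ) (l δ : ℝ) (X Y : ℕ → Vec p) : Prop :=
  ∀ i, 1 ≤ i → i + θ ≤ n + 1 → (∀ t ∈ Finset.Ico i (i + θ), X t = X i) →
    ‖denoised C l θ Y i - X i‖ < δ

/-- Both windows adjoining `c` are constant, so the statistic is at least `deltaMin - γ/2 - γ/2 ≥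
γ`. -/
theorem mem_nonzeroIdx_of_mem_changePoints (h : AccurateWindows C n θ l (γ / 2) X Y)
    (hθ : 1 ≤ θ) (hγ0 : 0 < γ) (hγ : γ ≤ deltaMin n X / 2)
    (hsep : ∀ a ∈ changePoints n X, ∀ b ∈ changePoints n X, a < b → a + 4 * θ ≤ b)
    {c : ℕ} (hc : c ∈ changePoints n X) (hθc : θ ≤ c) (hcn : c + θ ≤ n) :
    c ∈ nonzeroIdx n θ (thresholded γ (diffStat C l θ Y)) := by
  have hleft : ∀ t, c + 1 - θ ≤ t → t ≤ c → X t = X (c + 1 - θ) := fun t h1 h2 =>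
    eq_of_forall_notMem_changePoints (n := n) (b := c) (by omega) (by omega) (fun d hd hd' => by
      by_contra! hlt
      have := hsep d hd c hc hlt
      omega) h1 h2
  have hright : ∀ t, c + 1 ≤ t → t ≤ c + θ → X t = X (c + 1) := fun t h1 h2 =>
    eq_of_forall_notMem_changePoints (n := n) (b := c + θ) (by omega) hcn (fun d hd hd' => by
      have := hsep c hc d hd (by omega)
      omega) h1 h2
  have e1 := h (c + 1 - θ) (by omega) (by omega) fun t ht => by
    rw [Finset.mem_Ico] at ht
    exact hleft t ht.1 (by omega)
  have e2 := h (c + 1) (by omega) (by omega) fun t ht => by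
    rw [Finset.mem_Ico] at ht
    exact hright t ht.1 (by omega)
  rw [← hleft c (by omega) le_rfl] at e1
  have hS : γ ≤ diffStat C l θ Y c := by
    have h1 := deltaMin_le_norm_sub hc
    have h2 : ‖X c - X (c + 1)‖ ≤ ‖denoised C l θ Y (c + 1 - θ) - X c‖ +
        ‖denoised C l θ Y (c + 1) - X (c + 1)‖ + diffStat C l θ Y c := by
      have tri : ∀ a b u v : Vec p, ‖a - b‖ ≤ ‖u - a‖ + ‖v - b‖ + ‖v - u‖ := fun a b u v => by
        rw [norm_sub_rev u a, norm_sub_rev v u, show a - b = a - u + (v - b) + (u - v) by abel]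
        exact norm_add₃_le
      exact tri _ _ _ _
    linarith
  refine ⟨hθc, hcn, ?_⟩
  rw [thresholded, if_neg hS.not_gt]
  linarith

/-- Otherwise both windows see the same vector and the statistic is below `γ`; strict accuracy
matters, as thresholding keeps the value `γ`. -/
theorem exists_changePoint_near_of_mem_nonzeroIdx (h : AccurateWindows C n θ l (γ / 2) X Y)
    (hθ : 1 ≤ θ) {t : ℕ} (ht : t ∈ nonzeroIdx n θ (thresholded γ (diffStat C l θ Y))) :
    ∃ c ∈ changePoints n X, t < c + θ ∧ c < t + θ := by
  by_contra! hfar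
  obtain ⟨h1, h2, h3⟩ := ht
  have hconst : ∀ u, t + 1 - θ ≤ u → u ≤ t + θ → X u = X (t + 1 - θ) := fun u hu hu' =>
    eq_of_forall_notMem_changePoints (n := n) (by omega) h2
      (fun c hc hc' => hfar c hc (by omega)) hu hu'
  have hmid := hconst (t + 1) (by omega) (by omega)
  have e1 := h (t + 1 - θ) (by omega) (by omega) fun u hu => by
    rw [Finset.mem_Ico] at hu
    exact hconst u hu.1 (by omega)
  have e2 := h (t + 1) (by omega) (by omega) fun u hu => by
    rw [Finset.mem_Ico] at hu
    rw [hconst u (by omega) (by omega), hmid]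
  rw [hmid] at e2
  refine h3 (if_pos ?_)
  have := norm_sub_le_norm_sub_add_norm_sub (denoised C l θ Y (t + 1)) (X (t + 1 - θ))
    (denoised C l θ Y (t + 1 - θ))
  rw [norm_sub_rev (X _)] at this
  rw [diffStat]
  linarith

/-- Consecutive estimates enclose a segment on which the signal is constant. -/
theorem eq_of_consecutive (h : AccurateWindows C n θ l (γ / 2) X Y) (hθ : 1 ≤ θ) (hγ0 : 0 < γ)
    (hγ : γ ≤ deltaMin n X / 2)
    (hsep : ∀ a ∈ changePoints n X, ∀ b ∈ changePoints n X, a < b → a + 4 * θ ≤ b)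
    (hends : ∀ c ∈ changePoints n X, θ ≤ c ∧ c + θ ≤ n) {T : Finset ℕ}
    (hT : IsEstimate C n θ γ l Y T) {t₁ t₂ : ℕ} (h12 : Consecutive T t₁ t₂) :
    t₂ - θ ≤ n ∧ ∀ t ∈ Finset.Icc (t₁ + θ + 1) (t₂ - θ), X t = X (t₁ + θ + 1) := by
  have ht₂ := (hT.1 t₂ h12.2.1).1.2.1
  refine ⟨by omega, fun t ht => ?_⟩
  rw [Finset.mem_Icc] at ht
  exact eq_of_forall_notMem_changePoints (by omega) (by omega) (fun c hc hc' =>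
    h12.le_add_of_mem hsep hθ
      (fun c hc => mem_nonzeroIdx_of_mem_changePoints h hθ hγ0 hγ hsep hc (hends c hc).1
        (hends c hc).2)
      (fun t ht => exists_changePoint_near_of_mem_nonzeroIdx h hθ ht) hT hc hc') ht.1 ht.2

end Accurate

/-! ### Probabilities of the error bounds -/

theorem average_sub_eq_average_noise {p : ℕ} {X Y ε : ℕ → Vec p} {x : Vec p} {I : Finset ℕ}
    (hI0 : I.Nonempty) (hX : ∀ t ∈ I, X t = x) (hY : ∀ t ∈ I, Y t = X t + ε t) :
    (1 / (I.card : ℝ)) • ∑ t ∈ I, Y t - x = (1 / (I.card : ℝ)) • ∑ t ∈ I, ε t := by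
  have hc : (I.card : ℝ) ≠ 0 := by exact_mod_cast hI0.card_pos.ne'
  rw [Finset.sum_congr rfl fun t ht => by rw [hY t ht, hX t ht], Finset.sum_add_distrib,
    Finset.sum_const, smul_add, ← Nat.cast_smul_eq_nsmul ℝ, smul_smul, one_div_mul_cancel hc,
    one_smul, add_sub_cancel_left]

section Probability

variable {Ω : Type*} [MeasurableSpace Ω] {P : Measure Ω} [IsProbabilityMeasure P] {p n : ℕ} {σ : ℝ}
  {C : Set (Vec p)} {X : ℕ → Vec p} {ε Y : ℕ → Ω → Vec p} {l : ℝ}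

/-- The denoised average of observations with a constant signal is accurate with large
probability. -/
theorem measureReal_norm_prox_average_sub_ge_le (hσ : 0 < σ) (hC : Convex ℝ C)
    (hC0 : C ∈ 𝓝 (0 : Vec p))
    (hε : ∀ t ∈ Finset.Icc 1 n,
      HasLaw (ε t) (multivariateGaussian 0 (σ ^ 2 • (1 : Matrix (Fin p) (Fin p) ℝ))) P)
    (hindep : iIndepFun (fun t : Finset.Icc 1 n => ε t) P)
    (hY : ∀ t ∈ Finset.Icc 1 n, ∀ ω, Y t ω = X t + ε t ω) (hl : IsArgmin C n X l)
    {I : Finset ℕ} (hI : I ⊆ Finset.Icc 1 n) {i : ℕ} (hi : i ∈ I) (hX : ∀ t ∈ I, X t = X i) {s : ℝ}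
    (hs : 0 ≤ s) :
    P.real {ω | σ / √I.card * (gaussianDist C n X + s) ≤
      ‖prox C (σ / √I.card * l) ((1 / (I.card : ℝ)) • ∑ t ∈ I, Y t ω) - X i‖} ≤
      Real.exp (-s ^ 2 / 2) := by
  refine le_trans (measureReal_mono fun ω hω => ?_)
    (measureReal_infDist_average_noise_ge_le hσ hε hindep hI ⟨i, hi⟩ (subdiff (gauge C) (X i)) hs
      (expDist_le_gaussianDist hl (hI hi)))
  refine le_trans (α := ℝ) hω ((norm_prox_sub_le_infDist hC hC0
    (mul_nonneg (div_nonneg hσ.le (Real.sqrt_nonneg _)) hl.1) (X i) _).trans_eq ?_)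
  rw [average_sub_eq_average_noise ⟨i, hi⟩ hX fun t ht => hY t (hI ht) ω]

theorem measureReal_compl_errorBound_le (hσ : 0 < σ) (hC : Convex ℝ C)
    (hC0 : C ∈ 𝓝 (0 : Vec p))
    (hε : ∀ t ∈ Finset.Icc 1 n,
      HasLaw (ε t) (multivariateGaussian 0 (σ ^ 2 • (1 : Matrix (Fin p) (Fin p) ℝ))) P)
    (hindep : iIndepFun (fun t : Finset.Icc 1 n => ε t) P)
    (hY : ∀ t ∈ Finset.Icc 1 n, ∀ ω, Y t ω = X t + ε t ω) (hl : IsArgmin C n X l)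
    {θ t₁ t₂ : ℕ} (ht₂ : t₂ - θ ≤ n)
    (hX : ∀ t ∈ Finset.Icc (t₁ + θ + 1) (t₂ - θ), X t = X (t₁ + θ + 1)) (s : ℝ) :
    P.real {ω | ErrorBound C n X σ l s θ (fun t => Y t ω) t₁ t₂}ᶜ ≤ Real.exp (-s ^ 2 / 2) := by
  rcases (Finset.Icc (t₁ + θ + 1) (t₂ - θ)).eq_empty_or_nonempty with h0 | h0
  · have : {ω | ErrorBound C n X σ l s θ (fun t => Y t ω) t₁ t₂} = univ := by
      ext ω; simp [ErrorBound, h0]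
    rw [this, compl_univ, measureReal_empty]
    exact (Real.exp_pos _).le
  rw [Finset.nonempty_Icc] at h0
  -- Nonemptiness excludes truncation in `t₂ - θ`.
  have hd : duration θ t₁ t₂ = ((Finset.Icc (t₁ + θ + 1) (t₂ - θ)).card : ℝ) := by
    rw [Nat.card_Icc, show t₂ - θ + 1 - (t₁ + θ + 1) = t₂ - (t₁ + 2 * θ) by omega,
      Nat.cast_sub (by omega), duration]
    push_cast
    ring
  have hI : Finset.Icc (t₁ + θ + 1) (t₂ - θ) ⊆ Finset.Icc 1 n :=
    Finset.Icc_subset_Icc (by omega) ht₂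
  have key := measureReal_norm_prox_average_sub_ge_le hσ hC hC0 hε hindep hY hl hI
    (Finset.left_mem_Icc.2 h0) hX (abs_nonneg s)
  rw [sq_abs] at key
  refine le_trans (measureReal_mono fun ω hω => ?_) key
  by_contra hlt
  refine hω fun t ht => ?_
  simp only [mem_ofPred_eq, not_le, ← hd] at hlt
  have hd0 : 0 < duration θ t₁ t₂ := by
    rw [hd, Nat.cast_pos, Finset.card_pos, Finset.nonempty_Icc]; exact h0
  rw [hX t ht]
  have hη := gaussianDist_nonneg C n X
  calc ‖reconstruct C σ l θ (fun t => Y t ω) t₁ t₂ - X (t₁ + θ + 1)‖ ^ 2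
      ≤ (σ / √(duration θ t₁ t₂) * (gaussianDist C n X + |s|)) ^ 2 :=
        pow_le_pow_left₀ (norm_nonneg _) hlt.le 2
    _ = σ ^ 2 / duration θ t₁ t₂ * (gaussianDist C n X + |s|) ^ 2 := by
        rw [mul_pow, div_pow, Real.sq_sqrt hd0.le]
    _ ≤ σ ^ 2 / duration θ t₁ t₂ * (2 * (gaussianDist C n X ^ 2 + s ^ 2)) := by
        refine mul_le_mul_of_nonneg_left ?_ (by positivity)
        rw [← sq_abs s]
        exact add_sq_le
    _ = _ := by ring

/-- With large probability, every window with a constant signal is denoised accurately. -/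
theorem exists_measurableSet_accurateWindows (hσ : 0 < σ) (hC : Convex ℝ C)
    (hC0 : C ∈ 𝓝 (0 : Vec p))
    (hε : ∀ t ∈ Finset.Icc 1 n,
      HasLaw (ε t) (multivariateGaussian 0 (σ ^ 2 • (1 : Matrix (Fin p) (Fin p) ℝ))) P)
    (hindep : iIndepFun (fun t : Finset.Icc 1 n => ε t) P)
    (hY : ∀ t ∈ Finset.Icc 1 n, ∀ ω, Y t ω = X t + ε t ω) (hl : IsArgmin C n X l) {θ : ℕ}
    (hθ : 1 ≤ θ) {s : ℝ} (hs : 0 ≤ s) :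
    ∃ G : Set Ω, MeasurableSet G ∧ 1 - n * Real.exp (-s ^ 2 / 2) ≤ P.real G ∧ ∀ ω ∈ G,
      AccurateWindows C n θ (σ / √θ * l) (σ / √θ * (gaussianDist C n X + s)) X
        fun t => Y t ω := by
  classical
  set W := (Finset.Icc 1 n).filter fun i => i + θ ≤ n + 1 ∧ ∀ t ∈ Finset.Ico i (i + θ), X t = X i
  set B : ℕ → Set Ω := fun i => {ω | σ / √θ * (gaussianDist C n X + s) ≤
    ‖denoised C (σ / √θ * l) θ (fun t => Y t ω) i - X i‖} with hB
  have hBi : ∀ i ∈ W, P.real (B i) ≤ Real.exp (-s ^ 2 / 2) := fun i hi => by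
    obtain ⟨hi1, hi2, hi3⟩ := Finset.mem_filter.1 hi
    rw [Finset.mem_Icc] at hi1
    have key := measureReal_norm_prox_average_sub_ge_le hσ hC hC0 hε hindep hY hl
      (I := Finset.Ico i (i + θ)) (fun t ht => by
        rw [Finset.mem_Ico] at ht
        rw [Finset.mem_Icc]
        omega) (i := i) (by rw [Finset.mem_Ico]; omega) hi3 hs
    rw [Nat.card_Ico, Nat.add_sub_cancel_left] at key
    exact key
  have hU : P.real (⋃ i ∈ W, B i) ≤ n * Real.exp (-s ^ 2 / 2) := by
    refine (measureReal_biUnion_finset_le W B).trans ((Finset.sum_le_sum hBi).trans ?_)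
    rw [Finset.sum_const, nsmul_eq_mul]
    have : W.card ≤ n := (Finset.card_filter_le _ _).trans_eq (by simp)
    gcongr
  -- The measurable hull avoids any question of measurability of the denoiser.
  refine ⟨(toMeasurable P (⋃ i ∈ W, B i))ᶜ, (measurableSet_toMeasurable _ _).compl, ?_, ?_⟩
  · rw [probReal_compl_eq_one_sub (measurableSet_toMeasurable _ _), Measure.real,
      measure_toMeasurable]
    exact sub_le_sub_left hU 1
  · intro ω hω i hi1 hi2 hi3
    by_contra! hge
    refine hω (subset_toMeasurable _ _ (mem_biUnion (x := i) ?_ hge))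
    exact Finset.mem_filter.2 ⟨Finset.mem_Icc.2 ⟨hi1, by omega⟩, hi2, hi3⟩

end Probability

end ChangePoint

theorem proposition2
    {Ω : Type*} [MeasurableSpace Ω] (P : Measure Ω) [IsProbabilityMeasure P]
    (p n : ℕ) (σ r : ℝ) (hσ : 0 < σ) (hr : 1 < r)
    -- the convex set
    (C : Set (ChangePoint.Vec p)) (hC : Convex ℝ C) (hC0 : (0 : ChangePoint.Vec p) ∈ interior C)
    -- signal, noise and observations
    (X : ℕ → ChangePoint.Vec p) (ε Y : ℕ → Ω → ChangePoint.Vec p)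
    (hε : ∀ t ∈ Finset.Icc 1 n,
      HasLaw (ε t) (multivariateGaussian 0 (σ ^ 2 • (1 : Matrix (Fin p) (Fin p) ℝ))) P)
    (hindep : iIndepFun (fun t : Finset.Icc 1 n => ε t) P)
    (hY : ∀ t ∈ Finset.Icc 1 n, ∀ ω, Y t ω = X t + ε t ω)
    -- there are two change-points, so that the two minima are defined
    (hτ : (ChangePoint.changePoints n X).Nontrivial)
    (hsuff : 64 * σ ^ 2 * (ChangePoint.gaussianDist C n X + r * √(2 * Real.log n)) ^ 2 ≤
      ChangePoint.deltaMin n X ^ 2 * ChangePoint.Tmin n X)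
    (hends : ∀ t ∈ ChangePoint.changePoints n X,
      (ChangePoint.Tmin n X : ℝ) / 4 ≤ t ∧ (t : ℝ) ≤ n - (ChangePoint.Tmin n X : ℝ) / 4)
    -- the parameters of the algorithm
    (θ : ℕ) (γ l : ℝ) (hθ : 1 ≤ θ) (hθT : (θ : ℝ) ≤ (ChangePoint.Tmin n X : ℝ) / 4)
    (hγ : γ ≤ ChangePoint.deltaMin n X / 2)
    (hγ' : 2 * (σ / √θ) * (ChangePoint.gaussianDist C n X + r * √(2 * Real.log n)) ≤ γ)
    (hl : ChangePoint.IsArgmin C n X l)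
    -- the minimizer used for the reconstruction
    (l' : ℝ) (hl' : ChangePoint.IsArgmin C n X l') :
    -- for fixed times: with the stated probability the error bound holds
    -- whenever these times are consecutive estimates
    (∀ (t₁ t₂ : ℕ) (s : ℝ),
      1 - 4 * (n : ℝ) ^ (1 - r ^ 2) - Real.exp (-s ^ 2 / 2) <
        P.real {ω | ∀ T : Finset ℕ,
          ChangePoint.IsEstimate C n θ γ (σ / √θ * l) (fun t => Y t ω) T →
          ChangePoint.Consecutive T t₁ t₂ →
          ChangePoint.ErrorBound C n X σ l' s θ (fun t => Y t ω) t₁ t₂}) ∧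
    -- and, on an event that depends neither on the times nor on `s`, for all times that can
    -- occur as consecutive estimates the error bound itself holds with the stated probability
    ∃ G : Set Ω, MeasurableSet G ∧ 1 - 4 * (n : ℝ) ^ (1 - r ^ 2) < P.real G ∧
      ∀ ω₀ ∈ G, ∀ T : Finset ℕ,
        ChangePoint.IsEstimate C n θ γ (σ / √θ * l) (fun t => Y t ω₀) T →
        ∀ t₁ t₂ : ℕ, ChangePoint.Consecutive T t₁ t₂ → ∀ s : ℝ,
          1 - 4 * (n : ℝ) ^ (1 - r ^ 2) - Real.exp (-s ^ 2 / 2) <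
            P.real (G ∩ {ω | ChangePoint.ErrorBound C n X σ l' s θ (fun t => Y t ω) t₁ t₂}) := by
  have hC0' : C ∈ nhds (0 : ChangePoint.Vec p) := mem_interior_iff_mem_nhds.1 hC0
  obtain ⟨c₀, hc₀, -⟩ := hτ
  have hn1 : 1 < n := hc₀.1.trans_lt hc₀.2.1
  have hn0 : (0 : ℝ) < n := by exact_mod_cast hn1.le
  have hlog : 0 < Real.log n := Real.log_pos (by exact_mod_cast hn1)
  have h4θ : 4 * θ ≤ ChangePoint.Tmin n X := by
    have : (4 : ℝ) * θ ≤ ChangePoint.Tmin n X := by linarith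
    exact_mod_cast this
  have hsep : ∀ a ∈ ChangePoint.changePoints n X, ∀ b ∈ ChangePoint.changePoints n X,
      a < b → a + 4 * θ ≤ b := fun a ha b hb hab => by
    have := ChangePoint.Tmin_le_sub ha hb hab
    omega
  have hends' : ∀ c ∈ ChangePoint.changePoints n X, θ ≤ c ∧ c + θ ≤ n := fun c hc => by
    obtain ⟨h1, h2⟩ := hends c hc
    refine ⟨by exact_mod_cast hθT.trans h1, ?_⟩
    have : (c : ℝ) + θ ≤ n := by linarith
    exact_mod_cast this
  set s₀ := r * √(2 * Real.log n)
  have hs₀ : 0 < s₀ := mul_pos (by linarith) (Real.sqrt_pos.2 (by linarith))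
  have hθ0 : (0 : ℝ) < √θ := Real.sqrt_pos.2 (by exact_mod_cast hθ)
  have hη := ChangePoint.gaussianDist_nonneg C n X
  have hγ0 : 0 < γ := lt_of_lt_of_le (by positivity) hγ'
  have hexp : n * Real.exp (-s₀ ^ 2 / 2) = (n : ℝ) ^ (1 - r ^ 2) := by
    rw [mul_pow, Real.sq_sqrt (by linarith), sub_eq_add_neg, Real.rpow_add hn0, Real.rpow_one,
      Real.rpow_def_of_pos hn0]
    ring_nf
  have hpow : 0 < (n : ℝ) ^ (1 - r ^ 2) := Real.rpow_pos_of_pos hn0 _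
  obtain ⟨G, hGm, hGP, hG⟩ := ChangePoint.exists_measurableSet_accurateWindows hσ hC hC0' hε
    hindep hY hl hθ hs₀.le
  rw [hexp] at hGP
  have hconst : ∀ ω ∈ G, ∀ T : Finset ℕ,
      ChangePoint.IsEstimate C n θ γ (σ / √θ * l) (fun t => Y t ω) T →
      ∀ t₁ t₂ : ℕ, ChangePoint.Consecutive T t₁ t₂ →
      t₂ - θ ≤ n ∧ ∀ t ∈ Finset.Icc (t₁ + θ + 1) (t₂ - θ), X t = X (t₁ + θ + 1) :=
    fun ω hω T hT t₁ t₂ h12 => by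
      refine ChangePoint.eq_of_consecutive (fun i h1 h2 h3 => ?_) hθ hγ0 hγ hsep hends' hT h12
      -- The lower bound on `γ` says precisely that the accuracy is at most `γ/2`.
      exact (hG ω hω i h1 h2 h3).trans_le (by linarith)
  have hmain : ∀ ω₀ ∈ G, ∀ T : Finset ℕ,
      ChangePoint.IsEstimate C n θ γ (σ / √θ * l) (fun t => Y t ω₀) T →
      ∀ t₁ t₂ : ℕ, ChangePoint.Consecutive T t₁ t₂ → ∀ s : ℝ,
        1 - 4 * (n : ℝ) ^ (1 - r ^ 2) - Real.exp (-s ^ 2 / 2) <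
          P.real (G ∩ {ω | ChangePoint.ErrorBound C n X σ l' s θ (fun t => Y t ω) t₁ t₂}) :=
    fun ω₀ hω₀ T hT t₁ t₂ h12 s => by
      obtain ⟨ht₂, hX⟩ := hconst ω₀ hω₀ T hT t₁ t₂ h12
      have h1 := ChangePoint.measureReal_compl_errorBound_le hσ hC hC0' hε hindep hY hl' ht₂ hX s
      set E := {ω | ChangePoint.ErrorBound C n X σ l' s θ (fun t => Y t ω) t₁ t₂}
      have h2 : P.real G ≤ P.real (G ∩ E) + P.real Eᶜ :=
        (measureReal_mono fun ω hω => by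
          by_cases h : ω ∈ E
          · exact Or.inl ⟨hω, h⟩
          · exact Or.inr h).trans (measureReal_union_le (G ∩ E) Eᶜ)
      linarith
  refine ⟨fun t₁ t₂ s => ?_, G, hGm, by linarith, hmain⟩
  -- If the pair never occurs on `G`, the implication in (a) is vacuous on all of `G`.
  by_cases hocc : ∃ ω₀ ∈ G, ∃ T : Finset ℕ,
      ChangePoint.IsEstimate C n θ γ (σ / √θ * l) (fun t => Y t ω₀) T ∧
      ChangePoint.Consecutive T t₁ t₂
  · obtain ⟨ω₀, hω₀, T, hT, h12⟩ := hocc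
    exact (hmain ω₀ hω₀ T hT t₁ t₂ h12 s).trans_le
      (measureReal_mono fun ω hω _ _ _ => hω.2)
  · have h1 : P.real G ≤ P.real {ω | ∀ T : Finset ℕ,
        ChangePoint.IsEstimate C n θ γ (σ / √θ * l) (fun t => Y t ω) T →
        ChangePoint.Consecutive T t₁ t₂ →
        ChangePoint.ErrorBound C n X σ l' s θ (fun t => Y t ω) t₁ t₂} :=
      measureReal_mono fun ω hω T hT h12 => (hocc ⟨ω, hω, T, hT, h12⟩).elim
    have h2 := Real.exp_pos (-s ^ 2 / 2)
    linarith
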